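/- Let $n\ge 3$, let $S^{n-1}=\{v\in\mathbb{R}^n:|v|=1\}$, and let $P$ be the normalized $(n-1)$-dimensional Hausdorff measure on $S^{n-1}$. For $s\in\mathbb{R}$ and $u\in S^{n-1}$ put $C_s(u)=\{v\in S^{n-1}:u\cdot v\ge s\}$. A sequence $(x_j)_{j\ge1}$ in $S^{n-1}$ is called uniformly distributed if $\lim_{N\to\infty}\frac1N\#\{1\le j\le N:x_j\in A\}=P(A)$ for every set $A\subseteq S^{n-1}$ whose relative boundary satisfies $P(\partial A)=0$. The $d$-dimensional Legendre polynomials are given by $P^d_0(t)=1$, $P^d_1(t)=t$ and $(k+d-1)P^d_{k+2}(t)=(2k+d)\,t\,P^d_{k+1}(t)-(k+1)P^d_k(t)$ for $k\ge 0$. Let $s$ be a real zero of an $(n+2)$-dimensional Legendre polynomial $P^{n+2}_k$ of even degree $k$. Then there exists a sequence $(x_j)_{j\ge1}$ in $S^{n-1}$ such that $$\lim_{N\to\infty}\frac1N\#\{1\le j\le N:x_j\in C_s(u)\}=P(C_s(u))\qquad\text{for every }u\in S^{n-1},$$ but $(x_j)$ is not uniformly distributed. -/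

import Mathlib

open MeasureTheory Filter Topology

namespace SphereCaps

/-- The `d`-dimensional Legendre polynomial of degree `k` (an ultraspherical polynomial of
parameter `(d - 2) / 2`, normalized to take the value `1` at `1`), given by the standard
three-term recurrence
`(k + d - 1) P_{k+2} = (2k + d) X P_{k+1} - (k + 1) P_k`, `P_0 = 1`, `P_1 = X`.
For `d = 3` these are the classical Legendre polynomials. It is used for `d ≥ 2` only. -/
noncomputable def legendrePoly (d : ℕ) : ℕ → Polynomial ℝ
  | 0 => 1
  | 1 => Polynomial.X
  | k + 2 =>
      Polynomial.C ((2 * (k : ℝ) + d) / ((k : ℝ) + d - 1)) * Polynomial.X * legendrePoly d (k + 1)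
        - Polynomial.C (((k : ℝ) + 1) / ((k : ℝ) + d - 1)) * legendrePoly d k

/-- The unit sphere `S^{n-1}` of the Euclidean space `ℝⁿ`. -/
abbrev UnitSphere (n : ℕ) : Type :=
  Metric.sphere (0 : EuclideanSpace ℝ (Fin n)) 1

/-- The normalized `(n-1)`-dimensional Hausdorff measure on `S^{n-1}`. -/
noncomputable def sphereProb (n : ℕ) : Measure (UnitSphere n) :=
  (Measure.hausdorffMeasure ((n : ℝ) - 1) (Set.univ : Set (UnitSphere n)))⁻¹ •
    (Measure.hausdorffMeasure ((n : ℝ) - 1) : Measure (UnitSphere n))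

/-- The spherical cap `C_s(u) = {v ∈ S^{n-1} : u · v ≥ s}`. -/
def cap {n : ℕ} (s : ℝ) (u : UnitSphere n) : Set (UnitSphere n) :=
  {v | s ≤ inner ℝ (u : EuclideanSpace ℝ (Fin n)) (v : EuclideanSpace ℝ (Fin n))}

/-- The relative frequency with which the first `N` terms of the sequence `x` lie in `A`. -/
noncomputable def frequency {X : Type*} (x : ℕ → X) (A : Set X) (N : ℕ) : ℝ :=
  (1 / (N : ℝ)) * ∑ j ∈ Finset.range N, A.indicator (fun _ => (1 : ℝ)) (x j)

/-- The sequence `x` is `Q`-uniformly distributed: for every `Q`-continuity set `A`, the frequency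
with which `x` visits `A` tends to `Q A`. -/
def IsUniformlyDistributed {X : Type*} [TopologicalSpace X] [MeasurableSpace X]
    (Q : Measure X) (x : ℕ → X) : Prop :=
  ∀ A : Set X, Q (frontier A) = 0 → Tendsto (frequency x A) atTop (𝓝 (Q.real A))

end SphereCaps

/-!
The sequence is distributed according to a measure `ν` different from the uniform measure `μ` but
agreeing with it on all caps of height `s`. Take `ν = (1 + ε h) μ` with `h x = Q ⟪e, x⟫`, where
`e` is any point of the sphere and `Q` is the `n`-dimensional Legendre polynomial of degree `k + 1`;
a sequence uniformly distributed for `ν` exists by the strong law of large numbers.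

It remains to see that `h` has integral zero over every cap `{x | s ≤ ⟪u, x⟫}`. The function `h` is
an eigenfunction of the spherical Laplacian, with eigenvalue `c ≠ 0`, and `s` is a critical point of
`Q` because `Q'` is a multiple of the `(n + 2)`-dimensional Legendre polynomial of degree `k`. Hence
the truncation `w x = Q (max ⟪u, x⟫ s)` is of class `C^{1,1}`, and its Laplacian is `c Q ⟪u, x⟫` on
the cap and `0` off it. Green's formula `∫ Δw h = ∫ w Δh` then reads `∫ Q ⟪u, x⟫ h = ∫ w h`, the
left side being taken over the cap. As `w = Q ⟪u, x⟫` on the cap and `w = Q s ≠ 0` off it, `h` has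
integral zero over the complement of the cap, hence over the cap.

Green's formula needs only the rotation invariance of `μ`: integrals are constant along the flow of
a skew-symmetric operator, so derivatives along infinitesimal rotations have integral zero.
-/

namespace SphereCaps

section Legendre

open Polynomial

theorem legendrePoly_recurrence {d : ℕ} (hd : 2 ≤ d) (k : ℕ) :
    C ((k : ℝ) + d - 1) * legendrePoly d (k + 2) =
      C (2 * (k : ℝ) + d) * X * legendrePoly d (k + 1) - C ((k : ℝ) + 1) * legendrePoly d k := by
  have hd' : (2 : ℝ) ≤ d := mod_cast hd
  have h : (k : ℝ) + d - 1 ≠ 0 := by linarith [(k.cast_nonneg : (0 : ℝ) ≤ k)]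
  rw [legendrePoly, mul_sub, ← mul_assoc, ← mul_assoc, ← mul_assoc, ← C_mul, ← C_mul,
    mul_div_cancel₀ _ h, mul_div_cancel₀ _ h]

theorem one_sub_X_sq_mul_derivative_legendrePoly {d : ℕ} (hd : 2 ≤ d) (k : ℕ) :
    (1 - X ^ 2) * derivative (legendrePoly d (k + 1)) =
        C ((k : ℝ) + 1) * (legendrePoly d k - X * legendrePoly d (k + 1)) ∧
      (1 - X ^ 2) * derivative (legendrePoly d k) =
        C ((k : ℝ) + d - 2) * (X * legendrePoly d k - legendrePoly d (k + 1)) := by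
  induction k with
  | zero => simp [legendrePoly]; ring
  | succ k ih =>
    obtain ⟨lower, raise⟩ := ih
    have hd' : (2 : ℝ) ≤ d := mod_cast hd
    have hc : C ((k : ℝ) + d - 1) ≠ 0 := by
      rw [Ne, C_eq_zero]
      linarith [(k.cast_nonneg : (0 : ℝ) ≤ k)]
    have recurrence := legendrePoly_recurrence hd k
    have recurrence' := congrArg derivative recurrence
    simp only [derivative_mul, derivative_sub, derivative_C, derivative_X, zero_mul, zero_add,
      mul_one] at recurrence'
    simp only [C_add, C_sub, C_mul, C_1, Nat.cast_add, Nat.cast_one, C_ofNat] at *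
    constructor
    · apply mul_left_cancel₀ hc
      linear_combination (1 - X ^ 2) * recurrence' + (2 * C (k : ℝ) + C (d : ℝ)) * X * lower -
        (C (k : ℝ) + 1) * raise + (C (k : ℝ) + 2) * X * recurrence
    · linear_combination lower + recurrence

theorem one_sub_X_sq_ne_zero : (1 - X ^ 2 : ℝ[X]) ≠ 0 := fun h => by
  simpa using congrArg (eval 0) h

theorem derivative_legendrePoly_recurrence {d : ℕ} (hd : 2 ≤ d) (k : ℕ) :
    C (((k : ℝ) + 2) * (k + d) * (k + d - 1)) * derivative (legendrePoly d (k + 3)) =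
      C (((k : ℝ) + 3) * (2 * k + d + 2) * (k + d - 1)) * X * derivative (legendrePoly d (k + 2)) -
        C (((k : ℝ) + 3) * (k + 2) * (k + d)) * derivative (legendrePoly d (k + 1)) := by
  have raise₁ := (one_sub_X_sq_mul_derivative_legendrePoly hd (k + 1)).2
  have lower₂ := (one_sub_X_sq_mul_derivative_legendrePoly hd (k + 1)).1
  obtain ⟨lower₃, raise₂⟩ := one_sub_X_sq_mul_derivative_legendrePoly hd (k + 2)
  apply mul_left_cancel₀ one_sub_X_sq_ne_zero
  simp only [C_add, C_sub, C_mul, C_1, Nat.cast_add, Nat.cast_one, Nat.cast_ofNat, C_ofNat] at *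
  generalize (C (k : ℝ) : ℝ[X]) = K at *
  generalize (C (d : ℝ) : ℝ[X]) = D at *
  linear_combination (K + 2) * (K + D) * (K + D - 1) * lower₃ -
    (K + 3) * (K + D - 1) * X * ((K + 2) * raise₂ + (K + D) * lower₂) +
    (K + 3) * (K + 2) * (K + D) * raise₁

theorem derivative_legendrePoly_succ {d : ℕ} (hd : 2 ≤ d) (k : ℕ) :
    C ((d : ℝ) - 1) * derivative (legendrePoly d (k + 1)) =
      C (((k : ℝ) + 1) * (k + d - 1)) * legendrePoly (d + 2) k := by
  have hd' : (2 : ℝ) ≤ d := mod_cast hd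
  induction k using Nat.twoStepInduction with
  | zero => simp [legendrePoly]
  | one =>
    have hP₂ := congrArg derivative (legendrePoly_recurrence hd 0)
    simp only [legendrePoly, derivative_mul, derivative_sub, derivative_C, derivative_X,
      zero_mul, zero_add, mul_one, sub_zero] at hP₂ ⊢
    simp only [C_add, C_sub, C_mul, C_1, C_0, Nat.cast_zero, Nat.cast_one, C_ofNat] at hP₂ ⊢
    linear_combination hP₂
  | more k ih₀ ih₁ =>
    have hk : (0 : ℝ) ≤ k := k.cast_nonneg
    have hc : C (((k : ℝ) + 2) * (k + d) * (k + d - 1)) ≠ 0 := by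
      rw [Ne, C_eq_zero]
      refine mul_ne_zero (mul_ne_zero ?_ ?_) ?_ <;> linarith [hk]
    have recurrence := legendrePoly_recurrence (le_add_right hd : 2 ≤ d + 2) k
    have recurrence' := derivative_legendrePoly_recurrence hd k
    apply mul_left_cancel₀ hc
    simp only [C_add, C_sub, C_mul, C_1, Nat.cast_add, Nat.cast_one, Nat.cast_ofNat, C_ofNat] at *
    generalize (C (k : ℝ) : ℝ[X]) = K at *
    generalize (C (d : ℝ) : ℝ[X]) = D at *
    linear_combination (D - 1) * recurrence' +
      (K + 3) * ((K + D - 1) * (2 * K + D + 2) * X * ih₁ - (K + 2) * (K + D) * ih₀ -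
        (K + 2) * (K + D) * (K + D - 1) * recurrence)

theorem eval_derivative_legendrePoly_succ_eq_zero {d : ℕ} (hd : 2 ≤ d) {k : ℕ} {s : ℝ}
    (hs : (legendrePoly (d + 2) k).IsRoot s) :
    (derivative (legendrePoly d (k + 1))).eval s = 0 := by
  have hd' : (2 : ℝ) ≤ d := mod_cast hd
  have := congrArg (eval s) (derivative_legendrePoly_succ hd k)
  simpa [hs.eq_zero, (by linarith : (d : ℝ) - 1 ≠ 0)] using this

theorem legendrePoly_differential_equation {d : ℕ} (hd : 2 ≤ d) (k : ℕ) :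
    (1 - X ^ 2) * derivative (derivative (legendrePoly d (k + 1))) -
        C ((d : ℝ) - 1) * X * derivative (legendrePoly d (k + 1)) =
      -C (((k : ℝ) + 1) * (k + d - 1)) * legendrePoly d (k + 1) := by
  obtain ⟨lower, raise⟩ := one_sub_X_sq_mul_derivative_legendrePoly hd k
  have lower' := congrArg derivative lower
  simp only [derivative_mul, derivative_sub, derivative_C, derivative_X, derivative_one,
    derivative_X_pow, zero_mul, zero_add, one_mul] at lower'
  apply mul_left_cancel₀ one_sub_X_sq_ne_zero
  simp only [C_add, C_sub, C_mul, C_1, Nat.cast_ofNat, C_ofNat] at *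
  linear_combination (1 - X ^ 2) * lower' + (C (k : ℝ) + 1) * raise -
    (C (k : ℝ) + C (d : ℝ) - 2) * X * lower

theorem eval_legendrePoly_ne_zero_of_eval_succ_eq_zero {d : ℕ} (hd : 2 ≤ d) {k : ℕ} {s : ℝ}
    (h : (legendrePoly d (k + 1)).eval s = 0) : (legendrePoly d k).eval s ≠ 0 := by
  induction k with
  | zero => simp [legendrePoly]
  | succ k ih =>
    intro h₀
    refine ih h₀ ?_
    have := congrArg (eval s) (legendrePoly_recurrence hd k)
    simpa [h, h₀, Nat.cast_add_one_ne_zero] using this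

theorem eval_legendrePoly_ne_zero_of_eval_derivative_eq_zero {d : ℕ} (hd : 2 ≤ d) {k : ℕ} {s : ℝ}
    (h : (derivative (legendrePoly d (k + 1))).eval s = 0) :
    (legendrePoly d (k + 1)).eval s ≠ 0 := by
  intro h₁
  refine eval_legendrePoly_ne_zero_of_eval_succ_eq_zero hd h₁ ?_
  have := congrArg (eval s) (one_sub_X_sq_mul_derivative_legendrePoly hd k).1
  simpa [h, h₁, Nat.cast_add_one_ne_zero] using this

end Legendre

section UniformDistribution

variable {X : Type*}

theorem frequency_mono (x : ℕ → X) {A B : Set X} (h : A ⊆ B) (N : ℕ) :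
    frequency x A N ≤ frequency x B N := by
  unfold frequency
  gcongr

theorem frequency_compl (x : ℕ → X) (A : Set X) {N : ℕ} (hN : N ≠ 0) :
    frequency x Aᶜ N = 1 - frequency x A N := by
  have hN' : (N : ℝ) ≠ 0 := mod_cast hN
  rw [eq_sub_iff_add_eq, frequency, frequency, ← mul_add, ← Finset.sum_add_distrib]
  simp [Set.indicator_compl_add_self_apply, hN']

theorem isUniformlyDistributed_of_forall_isOpen [TopologicalSpace X] [MeasurableSpace X]
    [OpensMeasurableSpace X] {ν : Measure X} [IsProbabilityMeasure ν] {x : ℕ → X}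
    (h : ∀ G : Set X, IsOpen G → ∀ c < ν.real G, ∀ᶠ N in atTop, c < frequency x G N) :
    IsUniformlyDistributed ν x := by
  intro A hA
  have hclosure : ν.real (closure A) = ν.real A :=
    congrArg ENNReal.toReal (measure_closure_of_null_frontier hA)
  have hinterior : ν.real (interior A) = ν.real A :=
    congrArg ENNReal.toReal (measure_interior_of_null_frontier hA)
  refine tendsto_order.2 ⟨fun c hc => ?_, fun c hc => ?_⟩
  · filter_upwards [h _ isOpen_interior c (hinterior.symm ▸ hc)] with N hN
    exact hN.trans_le (frequency_mono x interior_subset N)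
  · have hcompl : 1 - c < ν.real (closure A)ᶜ := by
      rwa [probReal_compl_eq_one_sub isClosed_closure.measurableSet, hclosure, sub_lt_sub_iff_left]
    filter_upwards [h _ isClosed_closure.isOpen_compl _ hcompl, eventually_ne_atTop 0] with N hN hN₀
    rw [frequency_compl x _ hN₀] at hN
    linarith [frequency_mono x (subset_closure (s := A)) N]

theorem ae_tendsto_frequency [MeasurableSpace X] {Ω : Type*} [MeasurableSpace Ω] {P : Measure Ω}
    {ν : Measure X} [IsFiniteMeasure ν] {Y : ℕ → Ω → X}
    (hlaw : ∀ i, ProbabilityTheory.HasLaw (Y i) ν P) (hind : ProbabilityTheory.iIndepFun Y P)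
    {A : Set X} (hA : MeasurableSet A) :
    ∀ᵐ ω ∂P, Tendsto (frequency (fun i => Y i ω) A) atTop (𝓝 (ν.real A)) := by
  have hf : Measurable (A.indicator fun _ => (1 : ℝ)) := measurable_const.indicator hA
  have hint : Integrable (A.indicator fun _ => (1 : ℝ)) ν := (integrable_const 1).indicator hA
  have hident (i : ℕ) : ProbabilityTheory.IdentDistrib (Y i) (Y 0) P P :=
    (hlaw i).identDistrib (hlaw 0)
  have slln := ProbabilityTheory.strong_law_ae_real
    (fun i ω => A.indicator (fun _ => (1 : ℝ)) (Y i ω))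
    ((hlaw 0).map_eq.symm ▸ hint |>.comp_aemeasurable (hlaw 0).aemeasurable)
    (fun i j hij => (hind.indepFun hij).comp hf hf) (fun i => (hident i).comp hf)
  have hmean :
      ∫ ω, A.indicator (fun _ => (1 : ℝ)) (Y 0 ω) ∂P = ∫ y, A.indicator (fun _ => 1) y ∂ν :=
    (hlaw 0).integral_comp hf.aestronglyMeasurable
  rw [hmean, integral_indicator_const _ hA,
    smul_eq_mul, mul_one] at slln
  filter_upwards [slln] with ω hω
  exact hω.congr fun N => by rw [frequency, one_div_mul_eq_div]

theorem exists_countable_forall_isOpen_lt_measureReal [TopologicalSpace X]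
    [SecondCountableTopology X] [MeasurableSpace X] (ν : Measure X) [IsFiniteMeasure ν] :
    ∃ D : Set (Set X), D.Countable ∧ (∀ U ∈ D, IsOpen U) ∧
      ∀ G, IsOpen G → ∀ c < ν.real G, ∃ U ∈ D, U ⊆ G ∧ c < ν.real U := by
  obtain ⟨B, hB_countable, -, hB⟩ := TopologicalSpace.exists_countable_basis X
  refine ⟨Set.sUnion '' {S | S.Finite ∧ S ⊆ B},
    (Set.countable_ofPred_finite_subset hB_countable).image _, ?_, fun G hG c hc => ?_⟩
  · rintro _ ⟨S, ⟨-, hS⟩, rfl⟩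
    exact isOpen_sUnion fun U hU => hB.isOpen (hS hU)
  rcases lt_or_ge c 0 with hc₀ | hc₀
  · exact ⟨∅, ⟨∅, by simp⟩, by simpa using hc₀⟩
  let T : Set (Set (Set X)) := {S | S.Finite ∧ S ⊆ {U ∈ B | U ⊆ G}}
  have hT : T.Countable :=
    Set.countable_ofPred_finite_subset (hB_countable.mono (Set.sep_subset _ _))
  have hunion : ⋃ S ∈ T, ⋃₀ S = G := by
    refine Set.Subset.antisymm (Set.iUnion₂_subset fun S hS =>
      Set.sUnion_subset fun U hU => (hS.2 hU).2) fun x hx => ?_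
    obtain ⟨U, hU, hxU, hUG⟩ := hB.exists_subset_of_mem_open hx hG
    exact Set.mem_biUnion (x := {U}) ⟨Set.finite_singleton U, by simpa using ⟨hU, hUG⟩⟩ (by simpa)
  have hdirected : DirectedOn (Function.onFun (· ⊆ ·) Set.sUnion) T := fun S hS S' hS' =>
    ⟨S ∪ S', ⟨hS.1.union hS'.1, Set.union_subset hS.2 hS'.2⟩,
      Set.sUnion_mono Set.subset_union_left, Set.sUnion_mono Set.subset_union_right⟩
  rw [measureReal_def, ← ENNReal.ofReal_lt_iff_lt_toReal hc₀ (measure_ne_top ν G), ← hunion,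
    measure_biUnion_eq_iSup hT hdirected] at hc
  obtain ⟨S, hS, hcS⟩ := lt_biSup_iff.1 hc
  exact ⟨⋃₀ S, ⟨S, ⟨hS.1, fun U hU => (hS.2 hU).1⟩, rfl⟩, Set.sUnion_subset fun U hU => (hS.2 hU).2,
    (ENNReal.ofReal_lt_iff_lt_toReal hc₀ (measure_ne_top ν _)).1 hcS⟩

theorem exists_isUniformlyDistributed [TopologicalSpace X] [SecondCountableTopology X]
    [MeasurableSpace X] [OpensMeasurableSpace X] (ν : Measure X) [IsProbabilityMeasure ν] :
    ∃ x : ℕ → X, IsUniformlyDistributed ν x := by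
  obtain ⟨Ω, _, P, Y, -, hlaw, hind, _⟩ := ProbabilityTheory.exists_iid ℕ ν
  obtain ⟨D, hD, hopen, happrox⟩ := exists_countable_forall_isOpen_lt_measureReal ν
  obtain ⟨ω, hω⟩ := ((ae_ball_iff hD).2 fun U hU =>
    ae_tendsto_frequency hlaw hind (hopen U hU).measurableSet).exists
  refine ⟨fun i => Y i ω, isUniformlyDistributed_of_forall_isOpen fun G hG c hc => ?_⟩
  obtain ⟨U, hU, hUG, hcU⟩ := happrox G hG c hc
  filter_upwards [(hω U hU).eventually_const_lt hcU] with N hN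
  exact hN.trans_le (frequency_mono _ hUG N)

theorem IsUniformlyDistributed.measure_eq [PseudoMetricSpace X] [MeasurableSpace X]
    [BorelSpace X] {μ ν : Measure X} [IsProbabilityMeasure μ] [IsProbabilityMeasure ν]
    {x : ℕ → X} (hμ : IsUniformlyDistributed μ x) (hν : IsUniformlyDistributed ν x) : μ = ν := by
  have heq {A : Set X} (hA : (μ + ν) (frontier A) = 0) : μ A = ν A := by
    rw [Measure.add_apply, add_eq_zero] at hA
    exact (measureReal_eq_measureReal_iff).1 (tendsto_nhds_unique (hμ A hA.1) (hν A hA.2))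
  refine ext_of_generate_finite _
    (BorelSpace.measurable_eq.trans borel_eq_generateFrom_isClosed) isPiSystem_isClosed
    (fun F hF => ?_) (heq (by simp))
  obtain ⟨r, hr, hr_null⟩ := exists_null_frontiers_thickening (μ + ν) F
  have hr' : Tendsto r atTop (𝓝[>] 0) :=
    tendsto_nhdsWithin_iff.2 ⟨hr, .of_forall fun i => (hr_null i).1⟩
  have hlim (ρ : Measure X) [IsProbabilityMeasure ρ] :
      Tendsto (fun i => ρ (Metric.thickening (r i) F)) atTop (𝓝 (ρ F)) :=
    (tendsto_measure_thickening_of_isClosed ⟨1, one_pos, measure_ne_top _ _⟩ hF).comp hr'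
  exact tendsto_nhds_unique (hlim μ) ((hlim ν).congr fun i => (heq (hr_null i).2).symm)

theorem measureReal_withDensity_one_add [MeasurableSpace X] {μ : Measure X} [IsFiniteMeasure μ]
    {h : X → ℝ} (hint : Integrable h μ) (hpos : ∀ x, 0 ≤ 1 + h x) {A : Set X}
    (hA : MeasurableSet A) :
    (μ.withDensity fun x => ENNReal.ofReal (1 + h x)).real A = μ.real A + ∫ x in A, h x ∂μ := by
  rw [measureReal_def, withDensity_apply _ hA,
    ← integral_eq_lintegral_of_nonneg_ae (.of_forall hpos)
      ((integrable_const 1).add hint).aestronglyMeasurable.restrict,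
    integral_add (integrable_const 1) hint.integrableOn]
  simp

theorem exists_isProbabilityMeasure_ne_and_forall_eq [MeasurableSpace X] {μ : Measure X}
    [IsProbabilityMeasure μ] {h : X → ℝ} (hint : Integrable h μ) {C : ℝ} (hC : ∀ x, |h x| ≤ C)
    (hmean : ∫ x, h x ∂μ = 0) (hne : ¬ h =ᵐ[μ] 0) :
    ∃ ν : Measure X, IsProbabilityMeasure ν ∧ ν ≪ μ ∧ ν ≠ μ ∧
      ∀ A, MeasurableSet A → ∫ x in A, h x ∂μ = 0 → ν.real A = μ.real A := by
  obtain ⟨c, hc, hcC⟩ : ∃ c : ℝ, 0 < c ∧ c * C ≤ 1 := exists_pos_mul_lt one_pos C |>.imp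
    fun c hc => ⟨hc.1, mul_comm C c ▸ hc.2.le⟩
  have hpos (x : X) : 0 ≤ 1 + c * h x := by
    nlinarith [neg_le_of_abs_le (hC x)]
  let ν := μ.withDensity fun x => ENNReal.ofReal (1 + c * h x)
  have hν {A : Set X} (hA : MeasurableSet A) : ν.real A = μ.real A + c * ∫ x in A, h x ∂μ := by
    rw [← integral_const_mul]
    exact measureReal_withDensity_one_add (hint.const_mul c) hpos hA
  refine ⟨ν, ⟨?_⟩, withDensity_absolutelyContinuous _ _, fun heq => hne ?_, fun A hA hA₀ => ?_⟩
  · rw [← ENNReal.toReal_eq_one_iff, ← measureReal_def, hν .univ, setIntegral_univ, hmean]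
    simp
  · refine hint.ae_eq_zero_of_forall_setIntegral_eq_zero fun A hA _ => ?_
    simpa [heq, hc.ne'] using hν hA
  · rw [hν hA, hA₀, mul_zero, add_zero]

theorem exists_tendsto_frequency_and_not_isUniformlyDistributed [PseudoMetricSpace X]
    [SecondCountableTopology X] [MeasurableSpace X] [BorelSpace X] {μ : Measure X}
    [IsProbabilityMeasure μ] {h : X → ℝ} (hint : Integrable h μ) {C : ℝ} (hC : ∀ x, |h x| ≤ C)
    (hmean : ∫ x, h x ∂μ = 0) (hne : ¬ h =ᵐ[μ] 0) :
    ∃ x : ℕ → X,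
      (∀ A, MeasurableSet A → μ (frontier A) = 0 → ∫ y in A, h y ∂μ = 0 →
        Tendsto (frequency x A) atTop (𝓝 (μ.real A))) ∧
      ¬ IsUniformlyDistributed μ x := by
  obtain ⟨ν, _, hνμ, hν_ne, hν⟩ := exists_isProbabilityMeasure_ne_and_forall_eq hint hC hmean hne
  obtain ⟨x, hx⟩ := exists_isUniformlyDistributed ν
  refine ⟨x, fun A hA hA_frontier hA₀ => ?_, fun hxμ => hν_ne (hx.measure_eq hxμ)⟩
  exact hν A hA hA₀ ▸ hx A (hνμ hA_frontier)

end UniformDistribution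

section RotationInvariance

open Metric
open scoped RealInnerProductSpace

variable {E : Type*} [NormedAddCommGroup E] [InnerProductSpace ℝ E]

/-- The self-isometry of the unit sphere induced by a linear isometry of the ambient space. -/
def sphereIsometry (L : E ≃ₗᵢ[ℝ] E) : sphere (0 : E) 1 ≃ᵢ sphere (0 : E) 1 where
  toFun x := ⟨L x, by simp⟩
  invFun x := ⟨L.symm x, by simp⟩
  left_inv x := by simp
  right_inv x := by simp
  isometry_toFun := Isometry.of_dist_eq fun x y => L.dist_map x y

/-- Invariance of a measure on the unit sphere under the whole orthogonal group, reflections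
included. -/
def IsRotationInvariant [MeasurableSpace E] (μ : Measure (sphere (0 : E) 1)) : Prop :=
  ∀ L : E ≃ₗᵢ[ℝ] E, MeasurePreserving (sphereIsometry L) μ μ

theorem exists_sphereIsometry_apply_eq (u v : sphere (0 : E) 1) :
    ∃ L : E ≃ₗᵢ[ℝ] E, sphereIsometry L u = v :=
  ⟨_, Subtype.ext (Submodule.reflection_sub (v := (u : E)) (w := v) (by simp))⟩

theorem volume_inner_eq_mul_norm_of_nonneg [FiniteDimensional ℝ E] [MeasurableSpace E]
    [BorelSpace E] (hE : 2 ≤ Module.finrank ℝ E) {x : E} (hx : ‖x‖ = 1) {r : ℝ} (hr : 0 ≤ r) :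
    volume {y : E | ⟪y, x⟫ = r * ‖y‖} = 0 := by
  rcases lt_or_ge r 1 with hr₁ | hr₁
  · have hconvex : Convex ℝ {y : E | r * ‖y‖ - ⟪y, x⟫ ≤ 0} := by
      simpa [real_inner_comm x] using (((convexOn_norm convex_univ).smul hr).sub
        ((innerₗ E x).concaveOn convex_univ)).convex_le 0
    refine measure_mono_null (t := frontier {y : E | r * ‖y‖ - ⟪y, x⟫ ≤ 0})
      (fun y (hy : ⟪y, x⟫ = r * ‖y‖) => ⟨subset_closure (sub_eq_zero.2 hy.symm).le, fun hint => ?_⟩)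
      (hconvex.addHaar_frontier volume)
    obtain ⟨ε, hε, hball⟩ := Metric.isOpen_iff.1 isOpen_interior y hint
    have hmem : y - (ε / 2) • x ∈ ball y ε := by
      rw [mem_ball_iff_norm, sub_sub_cancel_left, norm_neg, norm_smul, hx, mul_one,
        Real.norm_of_nonneg (by positivity)]
      exact half_lt_self hε
    have hle := interior_subset (hball hmem)
    have hnorm : ‖y‖ - ε / 2 ≤ ‖y - (ε / 2) • x‖ := by
      simpa [norm_smul, hx, abs_of_pos hε] using norm_sub_norm_le y ((ε / 2) • x)
    rw [Set.mem_ofPred_eq, inner_sub_left, real_inner_smul_left, real_inner_self_eq_norm_sq, hx,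
      hy] at hle
    nlinarith
  · refine measure_mono_null (fun y (hy : ⟪y, x⟫ = r * ‖y‖) => ?_)
      (Measure.addHaar_submodule volume (ℝ ∙ x) fun htop => ?_)
    · have hcs : ⟪y, x⟫ = ‖y‖ * ‖x‖ := by
        refine le_antisymm (real_inner_le_norm y x) ?_
        rw [hy, hx, mul_one]
        exact le_mul_of_one_le_left (norm_nonneg y) hr₁
      have := inner_eq_norm_mul_iff_real.1 hcs
      rw [hx, one_smul] at this
      exact this ▸ Submodule.smul_mem _ _ (Submodule.mem_span_singleton_self x)
    · have := finrank_span_singleton (K := ℝ) (norm_ne_zero_iff.1 (hx ▸ one_ne_zero) : x ≠ 0)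
      rw [htop, finrank_top] at this
      omega

theorem volume_inner_eq_mul_norm [FiniteDimensional ℝ E] [MeasurableSpace E]
    [BorelSpace E] (hE : 2 ≤ Module.finrank ℝ E) {x : E} (hx : ‖x‖ = 1) (r : ℝ) :
    volume {y : E | ⟪y, x⟫ = r * ‖y‖} = 0 := by
  rcases le_total 0 r with hr | hr
  · exact volume_inner_eq_mul_norm_of_nonneg hE hx hr
  · have := volume_inner_eq_mul_norm_of_nonneg hE (x := -x) (by rwa [norm_neg]) (neg_nonneg.2 hr)
    simpa only [inner_neg_right, neg_mul, neg_inj] using this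

-- The measure does not depend on `u`, and almost every direction gives a null set by Fubini.
theorem IsRotationInvariant.measure_inner_eq [FiniteDimensional ℝ E] [MeasurableSpace E]
    [BorelSpace E] {μ : Measure (sphere (0 : E) 1)} [SFinite μ] (hμ : IsRotationInvariant μ)
    (hE : 2 ≤ Module.finrank ℝ E) (u : sphere (0 : E) 1) (r : ℝ) :
    μ {x | ⟪(u : E), x⟫ = r} = 0 := by
  have : Nontrivial E := Module.nontrivial_of_finrank_pos (R := ℝ) (by omega)
  have hmeas : MeasurableSet {p : sphere (0 : E) 1 × E | ⟪p.2, p.1⟫ ≠ r * ‖p.2‖} :=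
    (measurableSet_eq_fun (by fun_prop) (by fun_prop)).compl
  have hae : ∀ᵐ y : E, ∀ᵐ x : sphere (0 : E) 1 ∂μ, ⟪y, x⟫ ≠ r * ‖y‖ :=
    (Measure.ae_ae_comm hmeas).1 <| .of_forall fun x =>
      measure_eq_zero_iff_ae_notMem.1 (volume_inner_eq_mul_norm hE (norm_eq_of_mem_sphere x) r)
  obtain ⟨y, hy, hy₀⟩ := (hae.and (Measure.ae_ne volume 0)).exists
  let v : sphere (0 : E) 1 := ⟨‖y‖⁻¹ • y, by simp [norm_smul, hy₀]⟩
  have hv : μ {x | ⟪(v : E), x⟫ = r} = 0 := by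
    simp only [v, real_inner_smul_left, inv_mul_eq_iff_eq_mul₀ (norm_ne_zero_iff.2 hy₀),
      mul_comm _ r]
    exact measure_eq_zero_iff_ae_notMem.2 hy
  obtain ⟨L, hL⟩ := exists_sphereIsometry_apply_eq u v
  have hpreimage : {x : sphere (0 : E) 1 | ⟪(u : E), x⟫ = r} =
      sphereIsometry L ⁻¹' {x | ⟪(v : E), x⟫ = r} := by
    ext x
    rw [← hL]
    exact (congrArg (· = r) (L.inner_map_map u x)).symm.to_iff
  rw [hpreimage, (hμ L).measure_preimage_emb
    (sphereIsometry L).toHomeomorph.measurableEmbedding, hv]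

theorem exists_linearIsometryEquiv_hasDerivAt [CompleteSpace E] {A : E →L[ℝ] E}
    (hA : ∀ x y, ⟪A x, y⟫ = -⟪x, A y⟫) :
    ∃ R : ℝ → E ≃ₗᵢ[ℝ] E, (∀ x, R 0 x = x) ∧ ∀ x t, HasDerivAt (fun t => R t x) (A (R t x)) t := by
  have hskew (t : ℝ) : t • A ∈ skewAdjoint (E →L[ℝ] E) := by
    rw [skewAdjoint.mem_iff, ContinuousLinearMap.star_eq_adjoint, eq_comm,
      ContinuousLinearMap.eq_adjoint_iff]
    simp [inner_smul_left, inner_smul_right, hA]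
  let : NormedAlgebra ℚ (E →L[ℝ] E) := NormedAlgebra.restrictScalars ℚ ℝ _
  refine ⟨fun t => Unitary.linearIsometryEquiv
    ⟨NormedSpace.exp (t • A), NormedSpace.exp_mem_unitary_of_mem_skewAdjoint (hskew t)⟩,
    fun x => ?_, fun x t => ?_⟩
  · have hexp : NormedSpace.exp ((0 : ℝ) • A) = 1 := by rw [zero_smul, NormedSpace.exp_zero]
    exact congrArg (· x) hexp
  · exact (ContinuousLinearMap.apply ℝ _ x).hasFDerivAt.comp_hasDerivAt t
      (hasDerivAt_exp_smul_const' (𝕂 := ℝ) A t)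

/-- The infinitesimal rotation in the plane spanned by `v` and `u`, oriented from `v` to `u`. -/
noncomputable def infinitesimalRotation (v u : E) : E →L[ℝ] E :=
  (innerSL ℝ v).smulRight u - (innerSL ℝ u).smulRight v

theorem infinitesimalRotation_apply (v u x : E) :
    infinitesimalRotation v u x = ⟪v, x⟫ • u - ⟪u, x⟫ • v :=
  rfl

theorem inner_infinitesimalRotation_left (v u x y : E) :
    ⟪infinitesimalRotation v u x, y⟫ = -⟪x, infinitesimalRotation v u y⟫ := by
  simp only [infinitesimalRotation_apply, inner_sub_left, inner_sub_right, real_inner_smul_left,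
    real_inner_smul_right, real_inner_comm x]
  ring

theorem sum_inner_smul_infinitesimalRotation {ι : Type*} [Fintype ι] (b : OrthonormalBasis ι ℝ E)
    (u x : E) :
    ∑ i, ⟪b i, x⟫ • infinitesimalRotation (b i) u x = ‖x‖ ^ 2 • u - ⟪u, x⟫ • x := by
  have hu : ∑ i, ⟪b i, x⟫ • ⟪b i, x⟫ • u = ‖x‖ ^ 2 • u := by
    simp_rw [smul_smul, ← Finset.sum_smul, ← sq, b.sum_sq_inner_right]
  have hb : ∑ i, ⟪b i, x⟫ • ⟪u, x⟫ • b i = ⟪u, x⟫ • x := by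
    simp_rw [smul_comm _ ⟪u, x⟫, ← Finset.smul_sum, b.sum_repr']
  simp_rw [infinitesimalRotation_apply, smul_sub, Finset.sum_sub_distrib, hu, hb]

theorem sum_inner_infinitesimalRotation {ι : Type*} [Fintype ι] (b : OrthonormalBasis ι ℝ E)
    (u x : E) :
    ∑ i, ⟪b i, infinitesimalRotation (b i) u x⟫ = -((Fintype.card ι - 1) * ⟪u, x⟫) := by
  have hself (i) : ⟪b i, b i⟫ = (1 : ℝ) := by simp
  simp_rw [infinitesimalRotation_apply, inner_sub_right, real_inner_smul_right, hself,
    Finset.sum_sub_distrib, mul_comm ⟪b _, x⟫, real_inner_comm u, b.sum_inner_mul_inner]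
  simp
  ring

theorem sum_fderiv_inner_mul_infinitesimalRotation {ι : Type*} [Fintype ι]
    (b : OrthonormalBasis ι ℝ E) {f : E → ℝ} {x : E} (hf : DifferentiableAt ℝ f x) (u : E) :
    ∑ i, fderiv ℝ (fun x => ⟪b i, x⟫ * f x) x (infinitesimalRotation (b i) u x) =
      fderiv ℝ f x (‖x‖ ^ 2 • u - ⟪u, x⟫ • x) - (Fintype.card ι - 1) * (⟪u, x⟫ * f x) := by
  have hproduct (i) : fderiv ℝ (fun x => ⟪b i, x⟫ * f x) x (infinitesimalRotation (b i) u x) =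
      ⟪b i, x⟫ * fderiv ℝ f x (infinitesimalRotation (b i) u x) +
        f x * ⟪b i, infinitesimalRotation (b i) u x⟫ :=
    congrArg (· (infinitesimalRotation (b i) u x))
      ((innerSL ℝ (b i)).hasFDerivAt.mul hf.hasFDerivAt).fderiv
  have htangent := congrArg (fderiv ℝ f x) (sum_inner_smul_infinitesimalRotation b u x)
  simp only [map_sum, map_smul, smul_eq_mul] at htangent
  rw [Finset.sum_congr rfl fun i _ => hproduct i, Finset.sum_add_distrib, ← Finset.mul_sum,
    htangent, sum_inner_infinitesimalRotation]
  simp only [map_sub, map_smul, smul_eq_mul]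
  ring

theorem hasFDerivAt_inner_mul_inner {ψ χ : ℝ → ℝ} {u e x : E} (hψ : DifferentiableAt ℝ ψ ⟪u, x⟫)
    (hχ : DifferentiableAt ℝ χ ⟪e, x⟫) :
    HasFDerivAt (fun y => ψ ⟪u, y⟫ * χ ⟪e, y⟫)
      (ψ ⟪u, x⟫ • deriv χ ⟪e, x⟫ • innerSL ℝ e + χ ⟪e, x⟫ • deriv ψ ⟪u, x⟫ • innerSL ℝ u) x :=
  (hψ.hasDerivAt.comp_hasFDerivAt x (innerSL ℝ u).hasFDerivAt).mul
    (hχ.hasDerivAt.comp_hasFDerivAt x (innerSL ℝ e).hasFDerivAt)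

theorem fderiv_inner_mul_inner_tangential {ψ χ : ℝ → ℝ} {u e x : sphere (0 : E) 1}
    (hψ : DifferentiableAt ℝ ψ ⟪(u : E), x⟫) (hχ : DifferentiableAt ℝ χ ⟪(e : E), x⟫) :
    fderiv ℝ (fun y : E => ψ ⟪(u : E), y⟫ * χ ⟪(e : E), y⟫) x (u - ⟪(u : E), x⟫ • (x : E)) =
      (1 - ⟪(u : E), x⟫ ^ 2) * deriv ψ ⟪(u : E), x⟫ * χ ⟪(e : E), x⟫ +
        ψ ⟪(u : E), x⟫ * deriv χ ⟪(e : E), x⟫ *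
          (⟪(u : E), e⟫ - ⟪(u : E), x⟫ * ⟪(e : E), x⟫) := by
  rw [(hasFDerivAt_inner_mul_inner hψ hχ).fderiv]
  simp [inner_sub_right, real_inner_smul_right, real_inner_comm (u : E) e]
  ring

variable [FiniteDimensional ℝ E] [MeasurableSpace E] [BorelSpace E]
  {μ : Measure (sphere (0 : E) 1)} [IsFiniteMeasure μ]

theorem integrable_of_continuous {f : sphere (0 : E) 1 → ℝ} (hf : Continuous f) :
    Integrable f μ :=
  (BoundedContinuousFunction.mkOfCompact ⟨f, hf⟩).integrable μ

-- Differentiate the constant function `t ↦ ∫ g (R t x)`, where `R t = exp (t A)`.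
theorem IsRotationInvariant.integral_fderiv_skew (hμ : IsRotationInvariant μ) {A : E →L[ℝ] E}
    (hA : ∀ x y, ⟪A x, y⟫ = -⟪x, A y⟫) {g : E → ℝ} (hg : LocallyLipschitz g)
    (hg' : ∀ᵐ x : sphere (0 : E) 1 ∂μ, DifferentiableAt ℝ g x) :
    Integrable (fun x : sphere (0 : E) 1 => fderiv ℝ g x (A x)) μ ∧
      ∫ x : sphere (0 : E) 1, fderiv ℝ g x (A x) ∂μ = 0 := by
  obtain ⟨R, hR₀, hR⟩ := exists_linearIsometryEquiv_hasDerivAt hA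
  obtain ⟨K, hK⟩ := hg.locallyLipschitzOn.exists_lipschitzOnWith_of_compact
    (isCompact_sphere (0 : E) 1)
  have hcont : Continuous fun x : sphere (0 : E) 1 => g x :=
    hg.continuous.comp continuous_subtype_val
  have hR_lip (x : sphere (0 : E) 1) : LipschitzWith ‖A‖₊ fun t => R t x := by
    refine lipschitzWith_of_nnnorm_deriv_le (fun t => (hR x t).differentiableAt) fun t => ?_
    rw [(hR x t).deriv, ← NNReal.coe_le_coe]
    simpa using A.le_opNorm (R t x)
  have hmeas : Measurable fun x : sphere (0 : E) 1 => fderiv ℝ g x (A x) :=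
    isBoundedBilinearMap_apply.continuous.measurable.comp
      (((measurable_fderiv ℝ g).comp measurable_subtype_coe).prodMk
        (A.continuous.comp continuous_subtype_val).measurable)
  obtain ⟨hint, hderiv⟩ := hasDerivAt_integral_of_dominated_loc_of_lip (μ := μ) (x₀ := (0 : ℝ))
    (F := fun t (x : sphere (0 : E) 1) => g (R t x)) (s := Set.univ)
    (bound := fun _ => (K * ‖A‖₊ : NNReal)) univ_mem
    (.of_forall fun t => (hcont.comp (sphereIsometry (R t)).continuous).aestronglyMeasurable)
    (by simpa only [hR₀] using integrable_of_continuous hcont)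
    hmeas.aestronglyMeasurable
    (.of_forall fun x => by
      rw [Real.nnabs_of_nonneg (by positivity), Real.toNNReal_coe]
      exact hK.comp (hR_lip x).lipschitzOnWith fun t _ => (sphereIsometry (R t) x).2)
    (integrable_const _)
    (by
      filter_upwards [hg'] with x hx
      have hx₀ : HasFDerivAt g (fderiv ℝ g x) (R 0 x) := (hR₀ x).symm ▸ hx.hasFDerivAt
      simpa only [hR₀, Function.comp_def] using hx₀.comp_hasDerivAt 0 (hR x 0))
  have hconst (t : ℝ) : ∫ x : sphere (0 : E) 1, g (R t x) ∂μ = ∫ x : sphere (0 : E) 1, g x ∂μ :=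
    (hμ (R t)).integral_comp (sphereIsometry (R t)).toHomeomorph.measurableEmbedding
      fun x : sphere (0 : E) 1 => g x
  simp only [hconst] at hderiv
  exact ⟨hint, hderiv.unique (hasDerivAt_const _ _)⟩

-- Apply the previous identity to `⟪b i, x⟫ * f x` and the rotations in the planes of `b i` and `u`.
theorem IsRotationInvariant.integral_fderiv_tangential (hμ : IsRotationInvariant μ) (u : E)
    {f : E → ℝ} (hf : LocallyLipschitz f)
    (hf' : ∀ᵐ x : sphere (0 : E) 1 ∂μ, DifferentiableAt ℝ f x) :
    Integrable (fun x : sphere (0 : E) 1 => fderiv ℝ f x (u - ⟪u, x⟫ • (x : E))) μ ∧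
      ∫ x : sphere (0 : E) 1, fderiv ℝ f x (u - ⟪u, x⟫ • (x : E)) ∂μ =
        (Module.finrank ℝ E - 1) * ∫ x : sphere (0 : E) 1, ⟪u, x⟫ * f x ∂μ := by
  let b := stdOrthonormalBasis ℝ E
  have hlip (i) : LocallyLipschitz fun x => ⟪b i, x⟫ * f x :=
    (contDiff_mul (𝕜 := ℝ)).locallyLipschitz.comp
      ((innerSL ℝ (b i)).lipschitz.locallyLipschitz.prodMk hf)
  have hint (i) := hμ.integral_fderiv_skew (inner_infinitesimalRotation_left (b i) u) (hlip i)
    (hf'.mono fun x hx => (innerSL ℝ (b i)).differentiableAt.mul hx)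
  have hsum : (fun x : sphere (0 : E) 1 =>
      ∑ i, fderiv ℝ (fun x => ⟪b i, x⟫ * f x) x (infinitesimalRotation (b i) u x)) =ᵐ[μ]
      fun x => fderiv ℝ f x (u - ⟪u, x⟫ • (x : E)) -
        (Module.finrank ℝ E - 1) * (⟪u, x⟫ * f x) := by
    filter_upwards [hf'] with x hx
    simpa using sum_fderiv_inner_mul_infinitesimalRotation b hx u
  have hint_f : Integrable (fun x : sphere (0 : E) 1 => ⟪u, x⟫ * f x) μ :=
    integrable_of_continuous
      (((innerSL ℝ u).continuous.mul hf.continuous).comp continuous_subtype_val)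
  have hint_sum := (integrable_finsetSum Finset.univ fun i _ => (hint i).1).congr hsum
  have hint_tangential := (hint_sum.add (hint_f.const_mul _)).congr
    (.of_forall fun x => sub_add_cancel _ _)
  refine ⟨hint_tangential, ?_⟩
  rw [← sub_eq_zero, ← integral_const_mul, ← integral_sub hint_tangential (hint_f.const_mul _),
    ← integral_congr_ae hsum, integral_finsetSum _ fun i _ => (hint i).1]
  exact Finset.sum_eq_zero fun i _ => (hint i).2

/-- The second-order operator with `zonalLaplacian d φ ⟪u, x⟫` equal to the spherical Laplacian of
`x ↦ φ ⟪u, x⟫` on the unit sphere of a `d`-dimensional space. -/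
noncomputable def zonalLaplacian (d : ℕ) (φ : ℝ → ℝ) (t : ℝ) : ℝ :=
  (1 - t ^ 2) * deriv (deriv φ) t - (d - 1) * t * deriv φ t

theorem IsRotationInvariant.integral_zonalLaplacian_mul (hμ : IsRotationInvariant μ)
    (u e : sphere (0 : E) 1) {φ χ : ℝ → ℝ} (hφ : LocallyLipschitz (deriv φ))
    (hφ' : ∀ᵐ x : sphere (0 : E) 1 ∂μ, DifferentiableAt ℝ (deriv φ) ⟪(u : E), x⟫)
    (hχ : ContDiff ℝ 1 χ) :
    ∫ x : sphere (0 : E) 1, zonalLaplacian (Module.finrank ℝ E) φ ⟪(u : E), x⟫ *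
        χ ⟪(e : E), x⟫ ∂μ =
      -∫ x : sphere (0 : E) 1, deriv φ ⟪(u : E), x⟫ * deriv χ ⟪(e : E), x⟫ *
        (⟪(u : E), e⟫ - ⟪(u : E), x⟫ * ⟪(e : E), x⟫) ∂μ := by
  let f (x : E) : ℝ := deriv φ ⟪(u : E), x⟫ * χ ⟪(e : E), x⟫
  have hf : LocallyLipschitz f := (contDiff_mul (𝕜 := ℝ)).locallyLipschitz.comp
    ((hφ.comp (innerSL ℝ (u : E)).lipschitz.locallyLipschitz).prodMk
      (hχ.comp (innerSL ℝ (e : E)).contDiff).locallyLipschitz)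
  obtain ⟨hint, hparts⟩ := hμ.integral_fderiv_tangential (u : E) hf
    (hφ'.mono fun x hx =>
      (hasFDerivAt_inner_mul_inner hx (hχ.differentiable one_ne_zero _)).differentiableAt)
  have hφ_cont := hφ.continuous
  have hχ_cont := hχ.continuous
  have hint_grad : Integrable (fun x : sphere (0 : E) 1 => deriv φ ⟪(u : E), x⟫ *
      deriv χ ⟪(e : E), x⟫ * (⟪(u : E), e⟫ - ⟪(u : E), x⟫ * ⟪(e : E), x⟫)) μ :=
    integrable_of_continuous (by fun_prop)
  have hint_f : Integrable (fun x : sphere (0 : E) 1 => ⟪(u : E), x⟫ * f x) μ :=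
    integrable_of_continuous (by fun_prop)
  have hsplit : (fun x : sphere (0 : E) 1 =>
      zonalLaplacian (Module.finrank ℝ E) φ ⟪(u : E), x⟫ * χ ⟪(e : E), x⟫) =ᵐ[μ]
      fun x => fderiv ℝ f x (u - ⟪(u : E), x⟫ • (x : E)) -
        (Module.finrank ℝ E - 1) * (⟪(u : E), x⟫ * f x) - deriv φ ⟪(u : E), x⟫ *
          deriv χ ⟪(e : E), x⟫ * (⟪(u : E), e⟫ - ⟪(u : E), x⟫ * ⟪(e : E), x⟫) := by
    filter_upwards [hφ'] with x hx
    rw [fderiv_inner_mul_inner_tangential hx (hχ.differentiable one_ne_zero _), zonalLaplacian]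
    ring
  rw [integral_congr_ae hsplit, integral_sub (hint.sub' (hint_f.const_mul _)) hint_grad,
    integral_sub hint (hint_f.const_mul _), hparts, integral_const_mul, sub_self, zero_sub]

theorem IsRotationInvariant.integral_zonalLaplacian_mul_comm (hμ : IsRotationInvariant μ)
    (u e : sphere (0 : E) 1) {φ χ : ℝ → ℝ} (hφ : Differentiable ℝ φ)
    (hφ' : LocallyLipschitz (deriv φ))
    (hφ'' : ∀ᵐ x : sphere (0 : E) 1 ∂μ, DifferentiableAt ℝ (deriv φ) ⟪(u : E), x⟫)
    (hχ : ContDiff ℝ 2 χ) :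
    ∫ x : sphere (0 : E) 1, zonalLaplacian (Module.finrank ℝ E) φ ⟪(u : E), x⟫ *
        χ ⟪(e : E), x⟫ ∂μ =
      ∫ x : sphere (0 : E) 1,
        φ ⟪(u : E), x⟫ * zonalLaplacian (Module.finrank ℝ E) χ ⟪(e : E), x⟫ ∂μ := by
  have hχ' : ContDiff ℝ 1 (deriv χ) := hχ.deriv'
  simp_rw [mul_comm (φ _)]
  rw [hμ.integral_zonalLaplacian_mul u e hφ' hφ'' (hχ.of_le one_le_two),
    hμ.integral_zonalLaplacian_mul e u hχ'.locallyLipschitz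
      (.of_forall fun x => hχ'.differentiable one_ne_zero _)
      (contDiff_one_iff_deriv.2 ⟨hφ, hφ'.continuous⟩)]
  simp only [mul_comm, real_inner_comm]

theorem IsRotationInvariant.integral_zonal_eq_zero (hμ : IsRotationInvariant μ) {q : ℝ → ℝ} {c : ℝ}
    (hq : ContDiff ℝ 2 q) (hc : c ≠ 0)
    (hΔ : ∀ t ∈ Set.Icc (-1) 1, zonalLaplacian (Module.finrank ℝ E) q t = c * q t)
    (e : sphere (0 : E) 1) :
    ∫ x : sphere (0 : E) 1, q ⟪(e : E), x⟫ ∂μ = 0 := by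
  -- Green's formula against the constant `1`.
  have hgreen := hμ.integral_zonalLaplacian_mul e e (hq.deriv' (n := 1)).locallyLipschitz
    (.of_forall fun x => (hq.deriv' (n := 1)).differentiable one_ne_zero _)
    (contDiff_const (c := (1 : ℝ)))
  have hmem (x : sphere (0 : E) 1) : ⟪(e : E), x⟫ ∈ Set.Icc (-1 : ℝ) 1 :=
    real_inner_mem_Icc_of_norm_eq_one (norm_eq_of_mem_sphere e) (norm_eq_of_mem_sphere x)
  simpa [hΔ _ (hmem _), integral_const_mul, hc] using hgreen

theorem hasDerivAt_comp_max_of_ne {f : ℝ → ℝ} {s t : ℝ} (hf : DifferentiableAt ℝ f t)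
    (ht : t ≠ s) :
    HasDerivAt (fun t => f (max t s)) ((Set.Ici s).indicator (deriv f) t) t := by
  rcases ht.lt_or_gt with h | h
  · rw [Set.indicator_of_notMem (Set.notMem_Ici.2 h)]
    exact (hasDerivAt_const t (f s)).congr_of_eventuallyEq <|
      (eventually_lt_nhds h).mono fun y hy => by simp only [max_eq_right hy.le]
  · rw [Set.indicator_of_mem (Set.mem_Ici.2 h.le)]
    exact hf.hasDerivAt.congr_of_eventuallyEq <|
      (eventually_gt_nhds h).mono fun y hy => by simp only [max_eq_left hy.le]

theorem hasDerivAt_comp_max {f : ℝ → ℝ} (hf : Differentiable ℝ f) {s : ℝ} (hs : deriv f s = 0)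
    (t : ℝ) : HasDerivAt (fun t => f (max t s)) (deriv f (max t s)) t := by
  rcases eq_or_ne t s with rfl | ht
  · have hleft : HasDerivWithinAt (fun t' => f (max t' t)) 0 (Set.Iic t) t :=
      (hasDerivWithinAt_const t _ (f t)).congr_of_mem
        (fun y hy => by simp only [max_eq_right (Set.mem_Iic.1 hy)]) Set.self_mem_Iic
    have hright : HasDerivWithinAt (fun t' => f (max t' t)) 0 (Set.Ici t) t :=
      (hs ▸ (hf t).hasDerivAt.hasDerivWithinAt).congr_of_mem
        (fun y hy => by simp only [max_eq_left (Set.mem_Ici.1 hy)]) Set.self_mem_Ici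
    rw [max_self, hs, ← hasDerivWithinAt_univ, ← Set.Iic_union_Ici]
    exact hleft.union hright
  · convert hasDerivAt_comp_max_of_ne (hf t) ht
    rcases ht.lt_or_gt with h | h
    · rw [max_eq_right h.le, hs, Set.indicator_of_notMem (Set.notMem_Ici.2 h)]
    · rw [max_eq_left h.le, Set.indicator_of_mem (Set.mem_Ici.2 h.le)]

theorem zonalLaplacian_comp_max (d : ℕ) {q : ℝ → ℝ} (hq : ContDiff ℝ 2 q) {s t : ℝ}
    (hs : deriv q s = 0) (ht : t ≠ s) :
    zonalLaplacian d (fun t => q (max t s)) t = (Set.Ici s).indicator (zonalLaplacian d q) t := by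
  have hq' := hq.differentiable two_ne_zero
  have hderiv : deriv (fun t => q (max t s)) = fun t => deriv q (max t s) :=
    funext fun t => (hasDerivAt_comp_max hq' hs t).deriv
  rw [zonalLaplacian, (hasDerivAt_comp_max_of_ne (hq' t) ht).deriv, hderiv,
    (hasDerivAt_comp_max_of_ne (hq.differentiable_deriv_two t) ht).deriv]
  by_cases h : t ∈ Set.Ici s <;> simp [h, zonalLaplacian]

theorem IsRotationInvariant.setIntegral_zonalLaplacian_mul (hμ : IsRotationInvariant μ)
    (hE : 2 ≤ Module.finrank ℝ E) (u e : sphere (0 : E) 1) {q χ : ℝ → ℝ} (hq : ContDiff ℝ 2 q)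
    (hχ : ContDiff ℝ 2 χ) {s : ℝ} (hs : deriv q s = 0) :
    ∫ x in {x : sphere (0 : E) 1 | s ≤ ⟪(u : E), x⟫},
        zonalLaplacian (Module.finrank ℝ E) q ⟪(u : E), x⟫ * χ ⟪(e : E), x⟫ ∂μ =
      ∫ x : sphere (0 : E) 1,
        q (max ⟪(u : E), x⟫ s) * zonalLaplacian (Module.finrank ℝ E) χ ⟪(e : E), x⟫ ∂μ := by
  have hne : ∀ᵐ x : sphere (0 : E) 1 ∂μ, ⟪(u : E), x⟫ ≠ s :=
    measure_eq_zero_iff_ae_notMem.1 (hμ.measure_inner_eq hE u s)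
  have htrunc (t : ℝ) := hasDerivAt_comp_max (hq.differentiable two_ne_zero) hs t
  have hderiv : deriv (fun t => q (max t s)) = fun t => deriv q (max t s) :=
    funext fun t => (htrunc t).deriv
  rw [← hμ.integral_zonalLaplacian_mul_comm u e (fun t => (htrunc t).differentiableAt)
      (hderiv ▸ (hq.deriv' (n := 1)).locallyLipschitz.comp
        (LipschitzWith.id.max_const s).locallyLipschitz)
      (hne.mono fun x hx => hderiv ▸ (hasDerivAt_comp_max_of_ne
        (hq.differentiable_deriv_two _) hx).differentiableAt) hχ,
    ← integral_indicator (measurableSet_le measurable_const (by fun_prop))]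
  refine integral_congr_ae ?_
  filter_upwards [hne] with x hx
  rw [zonalLaplacian_comp_max _ hq hs hx]
  by_cases h : s ≤ ⟪(u : E), x⟫ <;> simp [h]

theorem IsRotationInvariant.setIntegral_zonal_eq_zero (hμ : IsRotationInvariant μ)
    (hE : 2 ≤ Module.finrank ℝ E) {q : ℝ → ℝ} {c : ℝ} (hq : ContDiff ℝ 2 q) (hc : c ≠ 0)
    (hΔ : ∀ t ∈ Set.Icc (-1) 1, zonalLaplacian (Module.finrank ℝ E) q t = c * q t)
    {s : ℝ} (hs : deriv q s = 0) (hs' : q s ≠ 0) (u e : sphere (0 : E) 1) :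
    ∫ x in {x : sphere (0 : E) 1 | s ≤ ⟪(u : E), x⟫}, q ⟪(e : E), x⟫ ∂μ = 0 := by
  have hgreen := hμ.setIntegral_zonalLaplacian_mul hE u e hq hq hs
  set cap : Set (sphere (0 : E) 1) := {x | s ≤ ⟪(u : E), x⟫}
  have hmem (v x : sphere (0 : E) 1) : ⟪(v : E), x⟫ ∈ Set.Icc (-1 : ℝ) 1 :=
    real_inner_mem_Icc_of_norm_eq_one (norm_eq_of_mem_sphere v) (norm_eq_of_mem_sphere x)
  have hcap : MeasurableSet cap := measurableSet_le measurable_const (by fun_prop)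
  have hq_cont := hq.continuous
  have hint : Integrable (fun x : sphere (0 : E) 1 => q (max ⟪(u : E), x⟫ s) * q ⟪(e : E), x⟫) μ :=
    integrable_of_continuous (by fun_prop)
  have hon : ∫ x in cap, q (max ⟪(u : E), x⟫ s) * q ⟪(e : E), x⟫ ∂μ =
      ∫ x in cap, q ⟪(u : E), x⟫ * q ⟪(e : E), x⟫ ∂μ :=
    setIntegral_congr_fun hcap fun x (hx : s ≤ _) => by simp only [max_eq_left hx]
  have hoff : ∫ x in capᶜ, q (max ⟪(u : E), x⟫ s) * q ⟪(e : E), x⟫ ∂μ =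
      q s * ∫ x in capᶜ, q ⟪(e : E), x⟫ ∂μ := by
    rw [← integral_const_mul]
    exact setIntegral_congr_fun hcap.compl fun x (hx : ¬ s ≤ _) => by
      simp only [max_eq_right (not_le.1 hx).le]
  simp only [hΔ _ (hmem _ _), mul_assoc, mul_left_comm _ c, integral_const_mul,
    ← integral_add_compl hcap hint, hon, hoff] at hgreen
  have hcompl : ∫ x in capᶜ, q ⟪(e : E), x⟫ ∂μ = 0 := by simpa [hc, hs'] using hgreen
  have htotal := integral_add_compl hcap
    (integrable_of_continuous (μ := μ) (f := fun x => q ⟪(e : E), x⟫) (by fun_prop))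
  rwa [hcompl, add_zero, hμ.integral_zonal_eq_zero hq hc hΔ e] at htotal

theorem IsRotationInvariant.not_eval_inner_ae_eq_zero [NeZero μ] (hμ : IsRotationInvariant μ)
    (hE : 2 ≤ Module.finrank ℝ E) {p : Polynomial ℝ} (hp : p ≠ 0) (e : sphere (0 : E) 1) :
    ¬ (fun x : sphere (0 : E) 1 => p.eval ⟪(e : E), x⟫) =ᵐ[μ] 0 := by
  have hroots : ∀ᵐ x : sphere (0 : E) 1 ∂μ, ∀ r ∈ p.roots.toFinset, ⟪(e : E), x⟫ ≠ r :=
    (ae_ball_iff (Finset.countable_toSet _)).2 fun r _ =>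
      measure_eq_zero_iff_ae_notMem.1 (hμ.measure_inner_eq hE e r)
  intro hzero
  obtain ⟨x, hx, hxroots⟩ := (hzero.and hroots).exists
  exact hxroots _ (by simpa [hp] using hx) rfl

theorem IsRotationInvariant.measure_frontier_setOf_le_inner (hμ : IsRotationInvariant μ)
    (hE : 2 ≤ Module.finrank ℝ E) (u : sphere (0 : E) 1) (s : ℝ) :
    μ (frontier {x : sphere (0 : E) 1 | s ≤ ⟪(u : E), x⟫}) = 0 :=
  measure_mono_null
    ((frontier_le_subset_eq continuous_const (by fun_prop)).trans fun _ hx => Eq.symm hx)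
    (hμ.measure_inner_eq hE u s)

theorem IsRotationInvariant.exists_tendsto_frequency_cap_and_not_isUniformlyDistributed
    {μ : Measure (sphere (0 : E) 1)} [IsProbabilityMeasure μ] (hμ : IsRotationInvariant μ)
    (hE : 2 ≤ Module.finrank ℝ E) {p : Polynomial ℝ} {c : ℝ} (hc : c ≠ 0)
    (hΔ : ∀ t ∈ Set.Icc (-1) 1,
      zonalLaplacian (Module.finrank ℝ E) (fun t => p.eval t) t = c * p.eval t)
    {s : ℝ} (hs : p.derivative.eval s = 0) (hs' : p.eval s ≠ 0) :
    ∃ x : ℕ → sphere (0 : E) 1,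
      (∀ u : sphere (0 : E) 1, Tendsto (frequency x {y | s ≤ ⟪(u : E), y⟫}) atTop
        (𝓝 (μ.real {y | s ≤ ⟪(u : E), y⟫}))) ∧
      ¬ IsUniformlyDistributed μ x := by
  obtain ⟨e⟩ := μ.nonempty_of_neZero
  have hp : ContDiff ℝ 2 fun t => p.eval t := p.contDiff_aeval 2
  have hcont : Continuous fun x : sphere (0 : E) 1 => p.eval ⟪(e : E), x⟫ := by fun_prop
  obtain ⟨C, hC⟩ := isCompact_univ.exists_bound_of_continuousOn hcont.continuousOn
  obtain ⟨x, hx, hx'⟩ := exists_tendsto_frequency_and_not_isUniformlyDistributed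
    (integrable_of_continuous hcont) (fun y => hC y trivial)
    (hμ.integral_zonal_eq_zero hp hc hΔ e)
    (hμ.not_eval_inner_ae_eq_zero hE (fun h => hs' (by simp [h])) e)
  refine ⟨x, fun u => hx _ (measurableSet_le measurable_const (by fun_prop))
    (hμ.measure_frontier_setOf_le_inner hE u s) ?_, hx'⟩
  exact hμ.setIntegral_zonal_eq_zero hE hp hc hΔ (p.deriv.trans hs) hs' u e

end RotationInvariance

section HausdorffMeasure

open Metric
open scoped RealInnerProductSpace

variable {E : Type*} [NormedAddCommGroup E] [InnerProductSpace ℝ E] [MeasurableSpace E]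
  [BorelSpace E] {m : ℕ} [Fact (Module.finrank ℝ E = m + 1)]

theorem isAddHaarMeasure_hausdorffMeasure_orthogonal_span_singleton (v : sphere (0 : E) 1) :
    (Measure.hausdorffMeasure m : Measure (ℝ ∙ (v : E))ᗮ).IsAddHaarMeasure := by
  have : FiniteDimensional ℝ E := .of_fact_finrank_eq_succ m
  have := MeasureTheory.isAddHaarMeasure_hausdorffMeasure (E := (ℝ ∙ (v : E))ᗮ)
  rwa [Submodule.finrank_orthogonal_span_singleton (n := m) (ne_zero_of_mem_unit_sphere v)] at this

theorem hausdorffMeasure_sphere_lt_top :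
    Measure.hausdorffMeasure m (Set.univ : Set (sphere (0 : E) 1)) < ⊤ := by
  have : FiniteDimensional ℝ E := .of_fact_finrank_eq_succ m
  refine isCompact_univ.measure_lt_top_of_nhdsWithin fun v _ => ?_
  let e := stereographic (norm_eq_of_mem_sphere (-v))
  have hsymm : LocallyLipschitz e.symm := fun w => by
    obtain ⟨K, t, ht, hK⟩ := (contDiff_stereoInvFunAux.comp
      (ℝ ∙ ((-v : sphere (0 : E) 1) : E))ᗮ.subtypeL.contDiff).locallyLipschitz w
    exact ⟨K, t, ht, hK⟩
  obtain ⟨K, hK⟩ := hsymm.locallyLipschitzOn.exists_lipschitzOnWith_of_compact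
    (isCompact_closedBall 0 1)
  have := isAddHaarMeasure_hausdorffMeasure_orthogonal_span_singleton (m := m) (-v)
  refine ⟨e.symm '' ball 0 1, ?_, ?_⟩
  · rw [nhdsWithin_univ]
    refine (e.isOpen_image_symm_of_subset_target isOpen_ball (Set.subset_univ _)).mem_nhds
      ⟨0, mem_ball_self one_pos, ?_⟩
    rw [← stereographic_neg_apply v]
    refine e.left_inv ?_
    rw [stereographic_source]
    exact ne_neg_of_mem_unit_sphere ℝ v
  · refine ((hK.mono ball_subset_closedBall).hausdorffMeasure_image_le m.cast_nonneg).trans_lt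
      (ENNReal.mul_lt_top (by simp) measure_ball_lt_top)

theorem hausdorffMeasure_sphere_pos :
    0 < Measure.hausdorffMeasure m (Set.univ : Set (sphere (0 : E) 1)) := by
  have : FiniteDimensional ℝ E := .of_fact_finrank_eq_succ m
  have hfinrank : Module.finrank ℝ E = m + 1 := Fact.out
  have : Nontrivial E := Module.nontrivial_of_finrank_eq_succ hfinrank
  obtain ⟨v⟩ : Nonempty (sphere (0 : E) 1) :=
    (NormedSpace.sphere_nonempty.2 zero_le_one).to_subtype
  have := isAddHaarMeasure_hausdorffMeasure_orthogonal_span_singleton (m := m) v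
  let π (x : sphere (0 : E) 1) := (ℝ ∙ (v : E))ᗮ.orthogonalProjectionOnto x
  have hπ : LipschitzWith 1 π := by
    simpa [π, Function.comp_def] using
      (Submodule.lipschitzWith_orthogonalProjectionOnto _).comp (LipschitzWith.subtype_val _)
  have hball : ball 0 1 ⊆ π '' Set.univ := fun w hw => by
    rw [mem_ball_zero_iff] at hw
    have hwv : ⟪(w : E), v⟫ = 0 := Submodule.mem_orthogonal_singleton_iff_inner_left.1 w.2
    have hnorm : ‖(w : E) + √(1 - ‖w‖ ^ 2) • (v : E)‖ = 1 := by
      rw [← sq_eq_sq₀ (norm_nonneg _) zero_le_one, norm_add_sq_real, real_inner_smul_right, hwv,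
        norm_smul, norm_eq_of_mem_sphere, Real.norm_of_nonneg (Real.sqrt_nonneg _), mul_one,
        Real.sq_sqrt (by nlinarith [norm_nonneg w])]
      simp
    refine ⟨⟨_, mem_sphere_zero_iff_norm.2 hnorm⟩, trivial, ?_⟩
    simp [π]
  simpa using (measure_ball_pos _ 0 one_pos).trans_le
    ((measure_mono hball).trans (hπ.hausdorffMeasure_image_le m.cast_nonneg Set.univ))

end HausdorffMeasure

section SphereProb

theorem isProbabilityMeasure_sphereProb {n : ℕ} (hn : 1 ≤ n) :
    IsProbabilityMeasure (sphereProb n) := by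
  obtain ⟨m, rfl⟩ := Nat.exists_eq_add_of_le' hn
  have hdim : ((m + 1 : ℕ) : ℝ) - 1 = m := by push_cast; ring
  have : Fact (Module.finrank ℝ (EuclideanSpace ℝ (Fin (m + 1))) = m + 1) :=
    ⟨finrank_euclideanSpace_fin⟩
  constructor
  rw [sphereProb, hdim]
  exact ENNReal.inv_mul_cancel hausdorffMeasure_sphere_pos.ne' hausdorffMeasure_sphere_lt_top.ne

theorem isRotationInvariant_sphereProb (n : ℕ) : IsRotationInvariant (sphereProb n) :=
  fun L => ((sphereIsometry L).measurePreserving_hausdorffMeasure _).smul_measure _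

theorem zonalLaplacian_legendrePoly {d : ℕ} (hd : 2 ≤ d) (k : ℕ) (t : ℝ) :
    zonalLaplacian d (fun t => (legendrePoly d (k + 1)).eval t) t =
      -((k + 1) * (k + d - 1)) * (legendrePoly d (k + 1)).eval t := by
  have hderiv (p : Polynomial ℝ) : deriv (fun t => p.eval t) = fun t => p.derivative.eval t :=
    funext fun _ => p.deriv
  have hode := congrArg (Polynomial.eval t) (legendrePoly_differential_equation hd k)
  simpa [zonalLaplacian, hderiv, -neg_add_rev] using hode

end SphereProb

end SphereCaps

theorem theorem3_general (n : ℕ) (hn : 2 ≤ n) (k : ℕ) (s : ℝ)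
    (hs : (SphereCaps.legendrePoly (n + 2) k).IsRoot s) :
    ∃ x : ℕ → SphereCaps.UnitSphere n,
      (∀ u : SphereCaps.UnitSphere n,
        Tendsto (SphereCaps.frequency x (SphereCaps.cap s u)) atTop
          (𝓝 ((SphereCaps.sphereProb n).real (SphereCaps.cap s u)))) ∧
      ¬ SphereCaps.IsUniformlyDistributed (SphereCaps.sphereProb n) x := by
  have : IsProbabilityMeasure (SphereCaps.sphereProb n) :=
    SphereCaps.isProbabilityMeasure_sphereProb (by lia)
  have hμ := SphereCaps.isRotationInvariant_sphereProb n
  have hfinrank : Module.finrank ℝ (EuclideanSpace ℝ (Fin n)) = n := finrank_euclideanSpace_fin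
  have hc : -(((k : ℝ) + 1) * (k + n - 1)) ≠ 0 := by
    have hn' : (2 : ℝ) ≤ n := mod_cast hn
    have hpos : 0 < (k : ℝ) + n - 1 := by linarith [(k.cast_nonneg : (0 : ℝ) ≤ k)]
    exact neg_ne_zero.2 (by positivity)
  have hcritical := SphereCaps.eval_derivative_legendrePoly_succ_eq_zero hn hs
  exact hμ.exists_tendsto_frequency_cap_and_not_isUniformlyDistributed
    (hfinrank.ge.trans' hn) hc
    (fun t _ => by rw [hfinrank, SphereCaps.zonalLaplacian_legendrePoly hn]) hcritical
    (SphereCaps.eval_legendrePoly_ne_zero_of_eval_derivative_eq_zero hn hcritical)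

theorem theorem3 (n : ℕ) (hn : 3 ≤ n) (k : ℕ) (hk : Even k) (s : ℝ)
    (hs : (SphereCaps.legendrePoly (n + 2) k).IsRoot s) :
    ∃ x : ℕ → SphereCaps.UnitSphere n,
      (∀ u : SphereCaps.UnitSphere n,
        Tendsto (SphereCaps.frequency x (SphereCaps.cap s u)) atTop
          (𝓝 ((SphereCaps.sphereProb n).real (SphereCaps.cap s u)))) ∧
      ¬ SphereCaps.IsUniformlyDistributed (SphereCaps.sphereProb n) x :=
  theorem3_general n (by lia) k s hs
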